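/- Let $X$ be a simply connected smooth manifold (finite-dimensional, Hausdorff, second countable, without boundary), and let $\xi=(h,F)$ be a Deligne $2$-class on $X$, represented by its Cheeger--Simons differential character: $h\colon Z_2(X)\to U(1)$ is a homomorphism on the group of smooth singular $2$-cycles and $F$ is a smooth $3$-form with $h(\partial\mu)=\exp\left(\int_\mu F\right)$ for every smooth singular $3$-chain $\mu$. Let $D$ be the closed unit disc, and let $\Sigma$ be a compact connected smooth surface whose boundary is one circle, identified with $S^1$ by a diffeomorphism $\beta\colon S^1\to\partial\Sigma$; let $\Sigma$ be orientable, oriented so that $\beta$ preserves orientations. Let $L(X)$, $D(X)$, $\Sigma(X)$ be the spaces of smooth maps of $S^1$, $D$, $\Sigma$ into $X$, and let $\partial$ denote restriction to the boundary circle. If $\sigma\in D(X)$ and $\nu\in D(X)$ or $\nu\in\Sigma(X)$ satisfy $\partial\sigma=\partial\nu$, let $\sigma\#\nu$ be the map on the closed surface glued from the two surfaces along the boundary circle, oriented by the first factor, and let $h(\sigma\#\nu)=h(\sigma_*d-\nu_*c)$, where $d$ and $c$ are smooth singular $2$-chains that represent the relative fundamental classes of the two surfaces and have the standard fundamental cycle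 of $S^1$ (the loop $t\mapsto e^{2\pi i t}$, $0\le t\le 1$) as boundary. Let $L_\xi\to L(X)$ be the bundle whose fibre over $\gamma$ is the set of classes $[\sigma,z]$ of pairs $(\sigma,z)$ with $\sigma\in D(X)$, $\partial\sigma=\gamma$, $z\in\mathbb C$, where $(\sigma,z)\sim(\sigma',z')$ if and only if $z=h(\sigma\#\sigma')z'$, with scalar multiplication $w[\sigma,z]=[\sigma,wz]$ and zero vector $[\sigma,0]$. For $(\sigma,\nu)\in D(X)\times\Sigma(X)$ with $\partial\sigma=\partial\nu$ put $\varphi_\xi(\sigma,\nu)=h(\sigma\#\nu)$. Then: 1. $\varphi_\xi(\sigma,\nu)$ does not change when $d$ is replaced by any other smooth $2$-chain in $D$ with the same boundary, or $c$ by a chain in $\Sigma$ that has the same boundary and differs from $c$ by the boundary of a smooth $3$-chain. 2. $\varphi_\xi(\sigma,\nu)=h(\sigma\#\sigma')\,\varphi_\xi(\sigma',\nu)$ whenever $\partial\sigma=\partial\sigma'=\partial\nu$, which is the transformation rule of a section of $\partial^{-1}(L_\xi)$. 3. $\varphi_\xi(\sigma,\nu)\neq0$ for all $(\sigma,\nu)$.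 4. There is a unique section $s$ of $\partial^{-1}(L_\xi)$ over $\Sigma(X)$ (a choice of $s(\nu)$ in the fibre of $L_\xi$ over $\partial\nu$ for every $\nu\in\Sigma(X)$) such that $s(\nu)=[\sigma,\varphi_\xi(\sigma,\nu)]$ for all $\nu\in\Sigma(X)$ and all $\sigma\in D(X)$ with $\partial\sigma=\partial\nu$. It vanishes nowhere, and it trivialises $\partial^{-1}(L_\xi)$: every vector of the fibre over $\nu$ is $w\,s(\nu)$ for exactly one $w\in\mathbb C$. -/

import Mathlib

open Set Metric MeasureTheory
open scoped Manifold ContDiff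

noncomputable section

namespace LoopLine

/-! ## Smooth maps between subsets of manifolds -/

section SmoothMaps

variable {E₁ : Type*} [NormedAddCommGroup E₁] [NormedSpace ℝ E₁]
  {H₁ : Type*} [TopologicalSpace H₁] {I₁ : ModelWithCorners ℝ E₁ H₁}
  {M₁ : Type*} [TopologicalSpace M₁] [ChartedSpace H₁ M₁]
  {E₂ : Type*} [NormedAddCommGroup E₂] [NormedSpace ℝ E₂]
  {H₂ : Type*} [TopologicalSpace H₂] {I₂ : ModelWithCorners ℝ E₂ H₂}
  {M₂ : Type*} [TopologicalSpace M₂] [ChartedSpace H₂ M₂]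
  {E₃ : Type*} [NormedAddCommGroup E₃] [NormedSpace ℝ E₃]
  {H₃ : Type*} [TopologicalSpace H₃] {I₃ : ModelWithCorners ℝ E₃ H₃}
  {M₃ : Type*} [TopologicalSpace M₃] [ChartedSpace H₃ M₃]

/-- A smooth map from a subset `S` of a manifold to a subset `T` of a manifold. It is used for the
closed simplices, for the closed disc, and (with `S = univ`) for manifolds with or without
boundary. -/
@[ext]
structure SMap (I₁ : ModelWithCorners ℝ E₁ H₁) (S : Set M₁)
    (I₂ : ModelWithCorners ℝ E₂ H₂) (T : Set M₂) where
  toFun : S → T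
  smooth' : ∃ g : M₁ → M₂, ContMDiffOn I₁ I₂ ∞ g S ∧ ∀ x : S, g x = toFun x

/-- Composition of smooth maps. -/
def SMap.comp {S : Set M₁} {T : Set M₂} {U : Set M₃} (f : SMap I₂ T I₃ U) (g : SMap I₁ S I₂ T) :
    SMap I₁ S I₃ U where
  toFun x := f.toFun (g.toFun x)
  smooth' := by
    obtain ⟨g', hg, hg'⟩ := g.smooth'
    obtain ⟨f', hf, hf'⟩ := f.smooth'
    refine ⟨f' ∘ g', hf.comp hg fun x hx => ?_, fun x => ?_⟩
    · have := hg' ⟨x, hx⟩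
      simp only at this
      rw [mem_preimage, this]
      exact (g.toFun ⟨x, hx⟩).2
    · rw [Function.comp_apply, hg', hf']

/-- A smooth map of manifolds as a smooth map between the full subsets. -/
def SMap.ofSmooth (f : C^∞⟮I₁, M₁; I₂, M₂⟯) :
    SMap I₁ (univ : Set M₁) I₂ (univ : Set M₂) where
  toFun x := ⟨f x.1, mem_univ _⟩
  smooth' := ⟨f, f.contMDiff.contMDiffOn, fun _ => rfl⟩

end SmoothMaps

/-! ## Smooth singular chains -/

/-- The standard `k`-simplex in `ℝᵏ`, with vertices `v₀ = 0` and `v₁, …, v_k` the standard basis. -/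
def stdSolid (k : ℕ) : Set (Fin k → ℝ) := {x | (∀ i, 0 ≤ x i) ∧ ∑ i, x i ≤ 1}

/-- The barycentric coordinates of `x` with respect to `v₀, …, v_k`. -/
def bary {k : ℕ} (x : Fin k → ℝ) : Fin (k + 1) → ℝ := Fin.cons (1 - ∑ i, x i) x

/-- The affine inclusion of the `i`-th face, the face opposite to the vertex `vᵢ`. -/
def faceFun {k : ℕ} (i : Fin (k + 2)) (x : Fin k → ℝ) : Fin (k + 1) → ℝ :=
  Fin.tail (i.insertNth (α := fun _ => ℝ) 0 (bary x))

lemma bary_nonneg {k : ℕ} {x : Fin k → ℝ} (hx : x ∈ stdSolid k) (j : Fin (k + 1)) :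
    0 ≤ bary x j := by
  refine Fin.cases ?_ (fun j => ?_) j
  · simpa [bary] using hx.2
  · simpa [bary] using hx.1 j

lemma insert_bary_nonneg {k : ℕ} (i : Fin (k + 2)) {x : Fin k → ℝ} (hx : x ∈ stdSolid k)
    (j : Fin (k + 2)) : 0 ≤ i.insertNth (α := fun _ => ℝ) 0 (bary x) j := by
  refine Fin.succAboveCases (α := fun j => 0 ≤ i.insertNth (α := fun _ => ℝ) 0 (bary x) j)
    i ?_ (fun l => ?_) j
  · simp
  · simpa using bary_nonneg hx l

lemma faceFun_mem {k : ℕ} (i : Fin (k + 2)) {x : Fin k → ℝ} (hx : x ∈ stdSolid k) :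
    faceFun i x ∈ stdSolid (k + 1) := by
  refine ⟨fun j => insert_bary_nonneg i hx j.succ, ?_⟩
  have h1 : ∑ j, i.insertNth (α := fun _ => ℝ) 0 (bary x) j = 1 := by
    rw [Fin.sum_univ_succAbove _ i]
    simp [bary, Fin.sum_univ_succ]
  rw [Fin.sum_univ_succ] at h1
  have h0 := insert_bary_nonneg i hx 0
  simp only [faceFun, Fin.tail]
  linarith

lemma contDiff_faceFun {k : ℕ} (i : Fin (k + 2)) : ContDiff ℝ ∞ (faceFun (k := k) i) := by
  have hb : ∀ l : Fin (k + 1), ContDiff ℝ ∞ fun x : Fin k → ℝ => bary x l := by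
    intro l
    refine Fin.cases ?_ (fun l => ?_) l
    · simp only [bary, Fin.cons_zero]
      fun_prop
    · simp only [bary, Fin.cons_succ]
      fun_prop
  have h : ∀ j : Fin (k + 2), ContDiff ℝ ∞ fun x : Fin k → ℝ =>
      i.insertNth (α := fun _ => ℝ) 0 (bary x) j := by
    intro j
    refine Fin.succAboveCases (α := fun j => ContDiff ℝ ∞ fun x : Fin k → ℝ =>
      i.insertNth (α := fun _ => ℝ) 0 (bary x) j) i ?_ (fun l => ?_) j
    · simpa using contDiff_const
    · simpa using hb l
  exact contDiff_pi.2 fun j => h j.succ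

/-- The inclusion of the `i`-th face as a smooth map of simplices. -/
def faceMap {k : ℕ} (i : Fin (k + 2)) :
    SMap 𝓘(ℝ, Fin k → ℝ) (stdSolid k) 𝓘(ℝ, Fin (k + 1) → ℝ) (stdSolid (k + 1)) where
  toFun x := ⟨faceFun i x.1, faceFun_mem i x.2⟩
  smooth' := ⟨faceFun i, (contDiff_faceFun i).contMDiff.contMDiffOn, fun _ => rfl⟩

section Chains

variable {E : Type*} [NormedAddCommGroup E] [NormedSpace ℝ E]
  {H : Type*} [TopologicalSpace H] (I : ModelWithCorners ℝ E H)
  {M : Type*} [TopologicalSpace M] [ChartedSpace H M]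
  {E' : Type*} [NormedAddCommGroup E'] [NormedSpace ℝ E']
  {H' : Type*} [TopologicalSpace H'] {J : ModelWithCorners ℝ E' H'}
  {N : Type*} [TopologicalSpace N] [ChartedSpace H' N]

/-- Smooth singular `k`-simplices with values in `S`. -/
abbrev Simplex (S : Set M) (k : ℕ) := SMap 𝓘(ℝ, Fin k → ℝ) (stdSolid k) I S

/-- Smooth singular `k`-chains in `S` with integer coefficients. -/
abbrev Chain (S : Set M) (k : ℕ) := Simplex I S k →₀ ℤ

variable {I}

/-- The boundary operator `∂ s = ∑ᵢ (-1)ⁱ s ∘ δᵢ`. -/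
def boundary {S : Set M} (k : ℕ) : Chain I S (k + 1) →ₗ[ℤ] Chain I S k :=
  Finsupp.linearCombination ℤ fun s : Simplex I S (k + 1) =>
    ∑ i : Fin (k + 2), (-1 : ℤ) ^ (i : ℕ) • Finsupp.single (s.comp (faceMap i)) (1 : ℤ)

/-- Push-forward of chains along a smooth map. -/
def push {S : Set M} {T : Set N} (f : SMap I S J T) (k : ℕ) : Chain I S k →ₗ[ℤ] Chain J T k :=
  Finsupp.lmapDomain ℤ ℤ fun s => f.comp s

lemma boundary_push {S : Set M} {T : Set N} (f : SMap I S J T) (k : ℕ) (c : Chain I S (k + 1)) :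
    boundary k (push f (k + 1) c) = push f k (boundary k c) := by
  have : (boundary k).comp (push f (k + 1)) = (push f k).comp (boundary k) := by
    refine Finsupp.lhom_ext' fun s => LinearMap.ext_ring ?_
    simp only [boundary, push, LinearMap.comp_apply, Finsupp.lsingle_apply,
      Finsupp.lmapDomain_apply, Finsupp.mapDomain_single, Finsupp.linearCombination_single,
      one_smul, map_sum, map_smul]
    rfl
  exact LinearMap.congr_fun this c

lemma push_push {E'' : Type*} [NormedAddCommGroup E''] [NormedSpace ℝ E'']
    {H'' : Type*} [TopologicalSpace H''] {K : ModelWithCorners ℝ E'' H''}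
    {P : Type*} [TopologicalSpace P] [ChartedSpace H'' P]
    {S : Set M} {T : Set N} {U : Set P} (f : SMap J T K U) (g : SMap I S J T) (k : ℕ)
    (c : Chain I S k) : push f k (push g k c) = push (f.comp g) k c := by
  simp only [push, Finsupp.lmapDomain_apply]
  rw [← Finsupp.mapDomain_comp]
  rfl

end Chains

/-! ## Differential characters -/

section Characters

variable (m : ℕ) (X : Type*) [TopologicalSpace X] [ChartedSpace (EuclideanSpace ℝ (Fin m)) X]

/-- A smooth complex-valued differential `k`-form on `X`: a family of alternating forms on the
tangent spaces whose expression in every preferred chart is smooth. -/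
structure DForm (k : ℕ) where
  toFun : ∀ x : X, TangentSpace (𝓡 m) x [⋀^Fin k]→L[ℝ] ℂ
  smooth' : ∀ x₀ : X, ContDiffOn ℝ ∞
    (fun y : EuclideanSpace ℝ (Fin m) =>
      ((toFun ((extChartAt (𝓡 m) x₀).symm y)).compContinuousLinearMap
        (mfderiv 𝓘(ℝ, EuclideanSpace ℝ (Fin m)) (𝓡 m) (extChartAt (𝓡 m) x₀).symm y) :
        EuclideanSpace ℝ (Fin m) [⋀^Fin k]→L[ℝ] ℂ))
    (extChartAt (𝓡 m) x₀).target

variable {m X}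

lemma zero_mem_stdSolid (k : ℕ) : (0 : Fin k → ℝ) ∈ stdSolid k := by simp [stdSolid]

open Classical in
/-- A smooth simplex in `X`, continued outside the standard simplex by a constant. -/
def Simplex.total {k : ℕ} (s : Simplex (𝓡 m) (univ : Set X) k) (x : Fin k → ℝ) : X :=
  if h : x ∈ stdSolid k then (s.toFun ⟨x, h⟩).1 else (s.toFun ⟨0, zero_mem_stdSolid k⟩).1

/-- The integral over the standard simplex of the pull-back of the `k`-form `η` along `s`. -/
def DForm.integralSimplex {k : ℕ} (η : DForm m X k) (s : Simplex (𝓡 m) (univ : Set X) k) : ℂ :=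
  ∫ x in stdSolid k, η.toFun (s.total x) fun i =>
    mfderivWithin 𝓘(ℝ, Fin k → ℝ) (𝓡 m) s.total (stdSolid k) x (Pi.single i (1 : ℝ) : Fin k → ℝ)

/-- The integral of a `k`-form over a smooth singular `k`-chain. -/
def DForm.integral {k : ℕ} (η : DForm m X k) (c : Chain (𝓡 m) (univ : Set X) k) : ℂ :=
  c.sum fun s n => (n : ℂ) * η.integralSimplex s

variable (m X)

/-- The group `Z₂(X)` of smooth singular `2`-cycles of `X`. -/
abbrev Cycles2 := LinearMap.ker (boundary (I := 𝓡 m) (S := (univ : Set X)) 1)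

/-- A differential character of degree two: a homomorphism `h : Z₂(X) → U(1)` and a (necessarily
imaginary-valued) `3`-form `F` with `h (∂μ) = exp (∫_μ F)` for every smooth `3`-chain `μ`. -/
structure DiffCharacter where
  h : Multiplicative (Cycles2 m X) →* Circle
  F : DForm m X 3
  h_boundary : ∀ (μ : Chain (𝓡 m) (univ : Set X) 3) (z : Cycles2 m X),
    (z : Chain (𝓡 m) (univ : Set X) 2) = boundary 2 μ →
      (h (Multiplicative.ofAdd z) : ℂ) = Complex.exp (F.integral μ)

variable {m X}

/-- The value of the character on a `2`-cycle, as a complex number. -/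
def DiffCharacter.val (ξ : DiffCharacter m X) (z : Cycles2 m X) : ℂ :=
  (ξ.h (Multiplicative.ofAdd z) : ℂ)

lemma DiffCharacter.val_zero (ξ : DiffCharacter m X) : ξ.val 0 = 1 := by
  simp [DiffCharacter.val]

lemma DiffCharacter.val_add (ξ : DiffCharacter m X) (z w : Cycles2 m X) :
    ξ.val (z + w) = ξ.val z * ξ.val w := by
  simp [DiffCharacter.val, ofAdd_add]

end Characters

/-! ## Gluing two surfaces along their boundary circle -/

/-- The standard fundamental `1`-cycle of the circle, the single simplex `t ↦ exp (2πit)`. -/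
def circleSimplex : Simplex (𝓡 1) (univ : Set Circle) 1 where
  toFun x := ⟨Circle.exp (2 * Real.pi * x.1 0), mem_univ _⟩
  smooth' := by
    refine ⟨fun x : Fin 1 → ℝ => Circle.exp (2 * Real.pi * x 0), ?_, fun _ => rfl⟩
    have h : ContDiff ℝ ∞ fun x : Fin 1 → ℝ => 2 * Real.pi * x 0 := by fun_prop
    exact (contMDiff_circleExp.comp h.contMDiff).contMDiffOn

def circleChain : Chain (𝓡 1) (univ : Set Circle) 1 := Finsupp.single circleSimplex 1

section Gluing

variable {E : Type*} [NormedAddCommGroup E] [NormedSpace ℝ E]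
  {H : Type*} [TopologicalSpace H] {I : ModelWithCorners ℝ E H}
  {M : Type*} [TopologicalSpace M] [ChartedSpace H M] {A : Set M}
  {E' : Type*} [NormedAddCommGroup E'] [NormedSpace ℝ E']
  {H' : Type*} [TopologicalSpace H'] {J : ModelWithCorners ℝ E' H'}
  {N : Type*} [TopologicalSpace N] [ChartedSpace H' N] {B : Set N}
  {m : ℕ} {X : Type*} [TopologicalSpace X] [ChartedSpace (EuclideanSpace ℝ (Fin m)) X]

/-- A smooth fundamental chain of a compact connected surface `A` whose boundary is one circle,
identified with `S¹` by `β`: a smooth `2`-chain with boundary the fundamental cycle `β_*[S¹]`.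
Such a chain represents the relative fundamental class of `A` for which the identification `β`
preserves orientations (the connecting map `H₂(A, ∂A) → H₁(∂A)` is injective, and it maps the
fundamental class to that of the boundary circle). It exists if and only if `A` is orientable;
an oriented triangulation gives one. -/
structure FundChain (β : SMap (𝓡 1) (univ : Set Circle) I A) where
  chain : Chain I A 2
  boundary_eq : boundary 1 chain = push β 1 circleChain

/-- The `2`-cycle `f # g` of the map given by `f` and `g` on the closed surface that is glued from
`A` and `B` along the boundary circle, oriented by the first factor. -/
def glue {βA : SMap (𝓡 1) (univ : Set Circle) I A} {βB : SMap (𝓡 1) (univ : Set Circle) J B}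
    (a : FundChain βA) (b : FundChain βB)
    (f : SMap I A (𝓡 m) (univ : Set X)) (g : SMap J B (𝓡 m) (univ : Set X))
    (hfg : f.comp βA = g.comp βB) : Cycles2 m X :=
  ⟨push f 2 a.chain - push g 2 b.chain, by
    rw [LinearMap.mem_ker, map_sub, boundary_push, boundary_push, a.boundary_eq, b.boundary_eq,
      push_push, push_push, hfg, sub_self]⟩

end Gluing

/-! ## The disc -/

/-- The closed unit disc `D`. -/
abbrev disc : Set ℂ := closedBall (0 : ℂ) 1

lemma contMDiff_coe_circle : ContMDiff (𝓡 1) 𝓘(ℝ, ℂ) ∞ (fun z : Circle => (z : ℂ)) := by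
  have : Fact (Module.finrank ℝ ℂ = 1 + 1) := ⟨Complex.finrank_real_complex⟩
  exact contMDiff_coe_sphere (n := 1) (E := ℂ)

/-- The inclusion of the boundary circle of `D`. -/
def discBdry : SMap (𝓡 1) (univ : Set Circle) 𝓘(ℝ, ℂ) disc where
  toFun z := ⟨(z.1 : ℂ), by simp [Circle.norm_coe]⟩
  smooth' := ⟨fun z => (z : ℂ), contMDiff_coe_circle.contMDiffOn, fun _ => rfl⟩

/-- The simplex `x ↦ r(x) exp (2πi t(x))` in `D`, for affine functions `r` and `t`. -/
def polarSimplex (r₁ r₂ t₁ t₂ : ℝ)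
    (hr : ∀ x ∈ stdSolid 2, |r₁ * x 0 + r₂ * x 1| ≤ 1) : Simplex 𝓘(ℝ, ℂ) disc 2 where
  toFun x := ⟨((r₁ * x.1 0 + r₂ * x.1 1 : ℝ) : ℂ) *
    Complex.exp ((2 * Real.pi * (t₁ * x.1 0 + t₂ * x.1 1) : ℝ) * Complex.I), by
      rw [mem_closedBall_zero_iff, norm_mul, Complex.norm_exp_ofReal_mul_I, mul_one,
        Complex.norm_real, Real.norm_eq_abs]
      exact hr _ x.2⟩
  smooth' := by
    refine ⟨fun x : Fin 2 → ℝ => ((r₁ * x 0 + r₂ * x 1 : ℝ) : ℂ) *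
      Complex.exp ((2 * Real.pi * (t₁ * x 0 + t₂ * x 1) : ℝ) * Complex.I), ?_, fun _ => rfl⟩
    have h1 : ContDiff ℝ ∞ fun x : Fin 2 → ℝ => ((r₁ * x 0 + r₂ * x 1 : ℝ) : ℂ) := by
      have h : ContDiff ℝ ∞ fun x : Fin 2 → ℝ => r₁ * x 0 + r₂ * x 1 := by fun_prop
      exact Complex.ofRealCLM.contDiff.comp h
    have h2 : ContDiff ℝ ∞ fun x : Fin 2 → ℝ =>
        (((2 * Real.pi * (t₁ * x 0 + t₂ * x 1) : ℝ)) : ℂ) := by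
      have h : ContDiff ℝ ∞ fun x : Fin 2 → ℝ => 2 * Real.pi * (t₁ * x 0 + t₂ * x 1) := by
        fun_prop
      exact Complex.ofRealCLM.contDiff.comp h
    exact (h1.mul (h2.mul contDiff_const).cexp).contMDiff.contMDiffOn

/-- The fundamental chain of `D` that triangulates the square of polar coordinates
`(r, t) ∈ [0, 1]²` by its diagonal; the last (constant) simplex cancels the collapsed side. -/
def discChain : Chain 𝓘(ℝ, ℂ) disc 2 :=
  Finsupp.single (polarSimplex 1 1 0 1 fun x hx => by
    have h0 := hx.1 0
    have h1 := hx.1 1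
    have h2 := hx.2
    rw [Fin.sum_univ_two] at h2
    rw [abs_le]; constructor <;> linarith) 1
  - Finsupp.single (polarSimplex 0 1 1 1 fun x hx => by
    have h0 := hx.1 0
    have h1 := hx.1 1
    have h2 := hx.2
    rw [Fin.sum_univ_two] at h2
    rw [abs_le]; constructor <;> linarith) 1
  + Finsupp.single (polarSimplex 0 0 0 0 fun x hx => by simp) 1

lemma faceFun_zero (x : Fin 1 → ℝ) : faceFun (k := 1) 0 x = ![1 - x 0, x 0] := by
  ext j
  fin_cases j
  · simp [faceFun, bary, Fin.tail]
  · simp only [faceFun, bary, Fin.tail, Fin.insertNth_zero]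
    rfl

lemma faceFun_one (x : Fin 1 → ℝ) : faceFun (k := 1) 1 x = ![0, x 0] := by
  ext j
  fin_cases j
  · simp [faceFun, bary, Fin.tail]
  · exact Fin.insertNth_apply_succAbove (α := fun _ => ℝ) (1 : Fin 3) 0 (bary x) 1

lemma faceFun_two (x : Fin 1 → ℝ) : faceFun (k := 1) 2 x = ![x 0, 0] := by
  ext j
  fin_cases j
  · exact Fin.insertNth_apply_succAbove (α := fun _ => ℝ) (2 : Fin 3) 0 (bary x) 1
  · exact Fin.insertNth_apply_same (α := fun _ => ℝ) (2 : Fin 3) 0 (bary x)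

lemma boundary_single {E : Type*} [NormedAddCommGroup E] [NormedSpace ℝ E]
    {H : Type*} [TopologicalSpace H] {I : ModelWithCorners ℝ E H}
    {M : Type*} [TopologicalSpace M] [ChartedSpace H M] {S : Set M} (s : Simplex I S 2) :
    boundary 1 (Finsupp.single s 1) = Finsupp.single (s.comp (faceMap 0)) 1
      - Finsupp.single (s.comp (faceMap 1)) 1 + Finsupp.single (s.comp (faceMap 2)) 1 := by
  simp [boundary, Finsupp.linearCombination_single, Fin.sum_univ_succ, sub_eq_add_neg, add_assoc]

lemma polar_ext {s t : Simplex 𝓘(ℝ, ℂ) disc 1}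
    (h : ∀ x, ((s.toFun x : disc) : ℂ) = (t.toFun x : disc)) : s = t :=
  SMap.ext (funext fun x => Subtype.ext (h x))

lemma boundary_discChain : boundary 1 discChain = push discBdry 1 circleChain := by
  simp only [discChain, circleChain, map_add, map_sub, boundary_single]
  simp only [push, Finsupp.lmapDomain_apply, Finsupp.mapDomain_single]
  set T₁ := polarSimplex 1 1 0 1 _
  set T₂ := polarSimplex 0 1 1 1 _
  set K := polarSimplex 0 0 0 0 _
  have e1 : T₁.comp (faceMap 0) = discBdry.comp circleSimplex := polar_ext fun x => by
    simp [T₁, SMap.comp, faceMap, polarSimplex, faceFun_zero, discBdry, circleSimplex,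
      Circle.coe_exp]
  have e2 : T₁.comp (faceMap 1) = T₂.comp (faceMap 1) := polar_ext fun x => by
    simp [T₁, T₂, SMap.comp, faceMap, polarSimplex, faceFun_one]
  have e3 : T₁.comp (faceMap 2) = T₂.comp (faceMap 0) := polar_ext fun x => by
    simp [T₁, T₂, SMap.comp, faceMap, polarSimplex, faceFun_zero, faceFun_two]
  have e4 : T₂.comp (faceMap 2) = K.comp (faceMap 0) := polar_ext fun x => by
    simp [T₂, K, SMap.comp, faceMap, polarSimplex, faceFun_two]
  have e5 : K.comp (faceMap 1) = K.comp (faceMap 0) := polar_ext fun x => by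
    simp [K, SMap.comp, faceMap, polarSimplex]
  have e6 : K.comp (faceMap 2) = K.comp (faceMap 0) := polar_ext fun x => by
    simp [K, SMap.comp, faceMap, polarSimplex]
  rw [e1, e2, e3, e4, e5, e6]
  abel

/-- The standard fundamental chain of the disc. -/
def discFund : FundChain discBdry := ⟨discChain, boundary_discChain⟩

/-! ## Loops, discs and surfaces in `X`, and the line bundle on the loop space -/

section LineBundle

variable (m : ℕ) (X : Type*) [TopologicalSpace X] [ChartedSpace (EuclideanSpace ℝ (Fin m)) X]

/-- The loop space `L(X)`. -/
abbrev LoopSpace := C^∞⟮𝓡 1, Circle; 𝓡 m, X⟯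

/-- The space `D(X)` of smooth maps of the closed disc into `X`. -/
abbrev DiscMap := SMap 𝓘(ℝ, ℂ) disc (𝓡 m) (univ : Set X)

variable {m X}

/-- The boundary loop of a disc in `X`. -/
def DiscMap.bdry (σ : DiscMap m X) : LoopSpace m X :=
  ⟨fun z => (σ.toFun ⟨(z : ℂ), by simp [Circle.norm_coe]⟩).1, by
    obtain ⟨g, hg, hg'⟩ := (SMap.comp σ discBdry).smooth'
    refine (contMDiffOn_univ.1 hg).congr fun z => ?_
    exact (hg' ⟨z, mem_univ z⟩).symm⟩

lemma DiscMap.comp_discBdry (σ : DiscMap m X) :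
    σ.comp discBdry = SMap.ofSmooth (DiscMap.bdry σ) := rfl

/-- For discs `σ` and `τ` with the same boundary loop, the number `h(σ # τ)`. -/
def sphereVal (ξ : DiffCharacter m X) (σ τ : DiscMap m X)
    (hστ : DiscMap.bdry σ = DiscMap.bdry τ) : ℂ :=
  ξ.val (glue discFund discFund σ τ (by
    rw [DiscMap.comp_discBdry, DiscMap.comp_discBdry, hστ]))

lemma sphereVal_self (ξ : DiffCharacter m X) (σ : DiscMap m X) :
    sphereVal ξ σ σ rfl = 1 := by
  rw [sphereVal, ← ξ.val_zero]
  congr 1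
  exact Subtype.ext (sub_self _)

lemma sphereVal_mul (ξ : DiffCharacter m X) {σ τ υ : DiscMap m X}
    (h₁ : DiscMap.bdry σ = DiscMap.bdry τ) (h₂ : DiscMap.bdry τ = DiscMap.bdry υ) :
    sphereVal ξ σ τ h₁ * sphereVal ξ τ υ h₂ = sphereVal ξ σ υ (h₁.trans h₂) := by
  rw [sphereVal, sphereVal, sphereVal, ← ξ.val_add]
  congr 1
  exact Subtype.ext (sub_add_sub_cancel _ _ _)

/-- The pairs `(σ, z)` of a disc `σ` with boundary loop `γ` and a complex number `z`. -/
abbrev PreFibre (γ : LoopSpace m X) := {σ : DiscMap m X // DiscMap.bdry σ = γ} × ℂ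

/-- The equivalence relation `(σ, h(σ # σ') z) ∼ (σ', z)` that defines the fibre of `L_ξ`. -/
def fibreSetoid (ξ : DiffCharacter m X) (γ : LoopSpace m X) : Setoid (PreFibre γ) where
  r p q := p.2 = sphereVal ξ p.1.1 q.1.1 (p.1.2.trans q.1.2.symm) * q.2
  iseqv := by
    refine ⟨fun p => ?_, fun {p q} h => ?_, fun {p q r} h₁ h₂ => ?_⟩
    · rw [sphereVal_self, one_mul]
    · rw [h, ← mul_assoc, sphereVal_mul, sphereVal_self, one_mul]
    · rw [h₁, h₂, ← mul_assoc, sphereVal_mul]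

/-- The fibre of the line bundle `L_ξ` over the loop `γ`. -/
def Fibre (ξ : DiffCharacter m X) (γ : LoopSpace m X) := Quotient (fibreSetoid ξ γ)

/-- The class `[σ, z]` in the fibre of `L_ξ` over `γ = ∂σ`. -/
def Fibre.mk (ξ : DiffCharacter m X) {γ : LoopSpace m X} (σ : DiscMap m X)
    (hσ : DiscMap.bdry σ = γ) (z : ℂ) : Fibre ξ γ :=
  Quotient.mk (fibreSetoid ξ γ) (⟨σ, hσ⟩, z)

/-- Multiplication by scalars in the fibre, `w • [σ, z] = [σ, w z]`. -/
instance (ξ : DiffCharacter m X) (γ : LoopSpace m X) : SMul ℂ (Fibre ξ γ) where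
  smul w := Quotient.map (fun p => (p.1, w * p.2)) fun p q h => by
    change w * p.2 = _ * (w * q.2)
    rw [show p.2 = _ from h]
    ring

/-- The zero vectors `[σ, 0]` of the fibre. -/
def Fibre.IsZero {ξ : DiffCharacter m X} {γ : LoopSpace m X} (v : Fibre ξ γ) : Prop :=
  ∃ (σ : DiscMap m X) (hσ : DiscMap.bdry σ = γ), v = Fibre.mk ξ σ hσ 0

variable {S : Type*} [TopologicalSpace S] [ChartedSpace (EuclideanHalfSpace 2) S]

variable (S) in
/-- An identification of the circle with the boundary of the surface `S`, so that the boundary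
has exactly one component. -/
structure BoundaryCircle where
  map : C^∞⟮𝓡 1, Circle; 𝓡∂ 2, S⟯
  injective : Function.Injective map
  immersion : ∀ z, Function.Injective (mfderiv (𝓡 1) (𝓡∂ 2) map z)
  range_eq : range map = (𝓡∂ 2).boundary S

/-- Fundamental chains of `S` for the given identification of its boundary with the circle. -/
abbrev SurfaceFund (β : BoundaryCircle S) := FundChain (SMap.ofSmooth β.map)

variable (m X S) in
/-- The space `Σ(X)` of smooth maps of the surface into `X`. -/
abbrev SurfaceMap := C^∞⟮𝓡∂ 2, S; 𝓡 m, X⟯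

/-- The map `∂ : Σ(X) → L(X)`. -/
def SurfaceMap.bdry (β : BoundaryCircle S) (ν : SurfaceMap m X S) : LoopSpace m X :=
  ContMDiffMap.comp ν β.map

variable (m X) in
/-- The fibre product of `D(X)` and `Σ(X)` over `L(X)`. -/
abbrev FibreProduct (β : BoundaryCircle S) :=
  {p : DiscMap m X × SurfaceMap m X S // DiscMap.bdry p.1 = SurfaceMap.bdry β p.2}

/-- The `2`-cycle `σ # ν`, computed with arbitrary fundamental chains. -/
def glueSurface {β : BoundaryCircle S} (d : FundChain discBdry) (c : SurfaceFund β)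
    (p : FibreProduct m X β) : Cycles2 m X :=
  glue d c p.1.1 (SMap.ofSmooth p.1.2) (by
    rw [DiscMap.comp_discBdry, p.2]; rfl)

/-- The function `φ_ξ(σ, ν) = h(σ # ν)` on the fibre product. -/
def canonicalFun (ξ : DiffCharacter m X) {β : BoundaryCircle S} (c : SurfaceFund β)
    (p : FibreProduct m X β) : ℂ :=
  ξ.val (glueSurface discFund c p)

/-- The transformation rule `s(σ, ν) = h(σ # σ') s(σ', ν)` of a section of `∂⁻¹(L_ξ)`. -/
def IsSectionRule (ξ : DiffCharacter m X) (β : BoundaryCircle S)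
    (s : FibreProduct m X β → ℂ) : Prop :=
  ∀ (ν : SurfaceMap m X S) (σ σ' : DiscMap m X)
    (hσ : DiscMap.bdry σ = SurfaceMap.bdry β ν) (hσ' : DiscMap.bdry σ' = SurfaceMap.bdry β ν),
    s ⟨(σ, ν), hσ⟩ = sphereVal ξ σ σ' (hσ.trans hσ'.symm) * s ⟨(σ', ν), hσ'⟩

/-- Sections of the pull-back `∂⁻¹(L_ξ)` over `Σ(X)`. -/
abbrev PullbackSection (ξ : DiffCharacter m X) (β : BoundaryCircle S) :=
  ∀ ν : SurfaceMap m X S, Fibre ξ (SurfaceMap.bdry β ν)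

/-- The section `s` of `∂⁻¹(L_ξ)` is given by the function `f` on the fibre product:
`s(ν) = [σ, f(σ, ν)]` for every disc `σ` with `∂σ = ∂ν`. -/
def PullbackSection.IsGivenBy {ξ : DiffCharacter m X} {β : BoundaryCircle S}
    (s : PullbackSection ξ β) (f : FibreProduct m X β → ℂ) : Prop :=
  ∀ (ν : SurfaceMap m X S) (σ : DiscMap m X) (hσ : DiscMap.bdry σ = SurfaceMap.bdry β ν),
    s ν = Fibre.mk ξ σ hσ (f ⟨(σ, ν), hσ⟩)

end LineBundle

end LoopLine

end

/-!
The value of a differential character on `σ # ν` is a number in `U(1)`, so `φ_ξ` has no zeros, and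
its transformation rule is additivity of the character on cycles: `σ # ν` is the sum of `σ # σ'` and
`σ' # ν`. Two facts need an argument.

The value does not depend on the fundamental chains. Two fundamental chains of the disc differ by a
cycle, and a cycle in a star-shaped set is a boundary, by the prism operator of the straight
contraction (`mem_range_boundary_of_cycle`); the prism is used and not the cone, because the cone
over a smooth simplex need not be smooth at its vertex. The character takes a boundary `∂μ` to the
exponential of `∫_μ F`. If `μ` comes from a surface, the integral of the `3`-form is zero, since the
derivatives of its simplices have rank at most two (`DForm.integral_push_eq_zero`).

The fibres of the bundle are not empty, that is, every smooth loop `γ` in the simply connected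
manifold bounds a smooth disc (`exists_discMap_bdry_eq`). A null homotopy gives a continuous
extension of `γ` to the plane that is `γ(z / |z|)` for `|z| ≥ 1/2`, hence smooth there. The rest of
the disc is covered by finitely many balls that the map sends into charts. In one ball after the
other the map is replaced, in the chart, by a smooth approximation, blended with a bump function
(`exists_smooth_modification`). The approximations are so close that all the balls are still sent
into their charts, and nothing changes on the unit circle.

A vector `[σ, a]` with `a ≠ 0` is a basis of its fibre. So the section is found by choosing a disc for
each `∂ν`, and the transformation rule says that the choice does not matter.
-/

open Set Metric MeasureTheory
open scoped Manifold ContDiff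

noncomputable section

namespace LoopLine

/-! ### Integrals over chains of smaller dimension -/

section IntegralPush

lemma convex_stdSolid (k : ℕ) : Convex ℝ (stdSolid k) := by
  have h : stdSolid k = (⋂ i, {x : Fin k → ℝ | 0 ≤ x i}) ∩ {x | ∑ i, x i ≤ 1} := by
    ext x; simp [stdSolid]
  rw [h]
  refine (convex_iInter fun i => ?_).inter ?_
  · exact convex_halfSpace_ge (LinearMap.proj (R := ℝ) (φ := fun _ : Fin k => ℝ) i).isLinear 0
  · refine convex_halfSpace_le (f := fun x : Fin k → ℝ => ∑ i, x i) ⟨fun x y => ?_, fun r x => ?_⟩ 1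
    · simp [Finset.sum_add_distrib]
    · simp [Finset.mul_sum]

lemma interior_stdSolid_nonempty (k : ℕ) : (interior (stdSolid k)).Nonempty := by
  have ho : IsOpen {x : Fin k → ℝ | (∀ i, 0 < x i) ∧ ∑ i, x i < 1} := by
    have : {x : Fin k → ℝ | (∀ i, 0 < x i) ∧ ∑ i, x i < 1} =
        (⋂ i, {x : Fin k → ℝ | 0 < x i}) ∩ {x | ∑ i, x i < 1} := by ext x; simp
    rw [this]
    exact (isOpen_iInter_of_finite fun i => isOpen_lt continuous_const (continuous_apply i)).inter
      (isOpen_lt (by fun_prop) continuous_const)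
  refine ⟨fun _ => 1 / (k + 1 : ℝ), mem_interior.2 ⟨_, fun x hx => ?_, ho, fun i => ?_, ?_⟩⟩
  · exact ⟨fun i => (hx.1 i).le, hx.2.le⟩
  · positivity
  · rw [Finset.sum_const, Finset.card_univ, Fintype.card_fin, nsmul_eq_mul, mul_one_div,
      div_lt_one (by positivity)]
    linarith

lemma uniqueMDiffOn_stdSolid (k : ℕ) : UniqueMDiffOn 𝓘(ℝ, Fin k → ℝ) (stdSolid k) :=
  (uniqueDiffOn_convex (convex_stdSolid k) (interior_stdSolid_nonempty k)).uniqueMDiffOn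

variable {E : Type*} [NormedAddCommGroup E] [NormedSpace ℝ E] [FiniteDimensional ℝ E]
  {H : Type*} [TopologicalSpace H] {I : ModelWithCorners ℝ E H}
  {M : Type*} [TopologicalSpace M] [ChartedSpace H M] {A : Set M}
  {m : ℕ} {X : Type*} [TopologicalSpace X] [ChartedSpace (EuclideanSpace ℝ (Fin m)) X]

/-- A `k`-form integrates to zero over a `k`-simplex that factors through a manifold of dimension
less than `k`: by the chain rule it is evaluated on vectors that are linearly dependent. -/
lemma DForm.integralSimplex_comp_eq_zero {k : ℕ} (hk : Module.finrank ℝ E < k) (η : DForm m X k)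
    (f : SMap I A (𝓡 m) (univ : Set X)) (s : Simplex I A k) :
    η.integralSimplex (f.comp s) = 0 := by
  refine setIntegral_eq_zero_of_forall_eq_zero fun x hx => ?_
  obtain ⟨f', hf, hf'⟩ := f.smooth'
  obtain ⟨s', hs, hs'⟩ := s.smooth'
  have hmaps : stdSolid k ⊆ s' ⁻¹' A := fun y hy => by
    rw [mem_preimage, hs' ⟨y, hy⟩]
    exact (s.toFun ⟨y, hy⟩).2
  have heq : ∀ y ∈ stdSolid k, Simplex.total (f.comp s) y = (f' ∘ s') y := fun y hy => by
    rw [Simplex.total, dif_pos hy, Function.comp_apply, hs' ⟨y, hy⟩, hf']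
    rfl
  have hd : mfderivWithin 𝓘(ℝ, Fin k → ℝ) (𝓡 m) (Simplex.total (f.comp s)) (stdSolid k) x =
      mfderivWithin 𝓘(ℝ, Fin k → ℝ) (𝓡 m) (f' ∘ s') (stdSolid k) x :=
    mfderivWithin_congr heq (heq x hx)
  rw [mfderivWithin_comp (I' := I) x ((hf _ (hmaps hx)).mdifferentiableWithinAt (by simp))
    ((hs x hx).mdifferentiableWithinAt (by simp)) hmaps (uniqueMDiffOn_stdSolid k x hx)] at hd
  set P : E →L[ℝ] EuclideanSpace ℝ (Fin m) := mfderivWithin I (𝓡 m) f' A (s' x)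
  set Q : (Fin k → ℝ) →L[ℝ] E := mfderivWithin 𝓘(ℝ, Fin k → ℝ) I s' (stdSolid k) x
  have hv : ¬ LinearIndependent ℝ fun i : Fin k => P (Q (Pi.single i (1 : ℝ))) := fun h => by
    have h' : LinearIndependent ℝ fun i : Fin k => Q (Pi.single i (1 : ℝ)) :=
      LinearIndependent.of_comp (P : E →ₗ[ℝ] EuclideanSpace ℝ (Fin m)) h
    have := h'.fintype_card_le_finrank
    rw [Fintype.card_fin] at this
    omega
  have hz := AlternatingMap.map_linearDependent
    (η.toFun (Simplex.total (f.comp s) x)).toAlternatingMap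
    (fun i : Fin k => P (Q (Pi.single i (1 : ℝ)))) hv
  rw [hd]
  exact hz

lemma DForm.integral_push_eq_zero {k : ℕ} (hk : Module.finrank ℝ E < k) (η : DForm m X k)
    (f : SMap I A (𝓡 m) (univ : Set X)) (μ : Chain I A k) : η.integral (push f k μ) = 0 := by
  classical
  refine Finset.sum_eq_zero fun s hs => ?_
  obtain ⟨t, -, rfl⟩ := Finset.mem_image.1 (Finsupp.mapDomain_support hs)
  simp only [η.integralSimplex_comp_eq_zero hk, mul_zero]

/-- A differential character is trivial on the image of the boundary of a `3`-chain in a manifold of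
dimension less than three. -/
lemma DiffCharacter.val_push_boundary (hE : Module.finrank ℝ E < 3) (ξ : DiffCharacter m X)
    (f : SMap I A (𝓡 m) (univ : Set X)) (μ : Chain I A 3) (z : Cycles2 m X)
    (hz : (z : Chain (𝓡 m) (univ : Set X) 2) = push f 2 (boundary 2 μ)) : ξ.val z = 1 := by
  rw [DiffCharacter.val, ξ.h_boundary (push f 3 μ) z (by rw [hz, boundary_push]),
    ξ.F.integral_push_eq_zero hE, Complex.exp_zero]

end IntegralPush

/-! ### Cycles in star-shaped sets -/

section Prism

variable {V : Type*} [NormedAddCommGroup V] [NormedSpace ℝ V] {A : Set V}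

lemma smul_mem_of_starConvex (hA : StarConvex ℝ 0 A) {v : V} (hv : v ∈ A) {t : ℝ}
    (ht : t ∈ Icc (0 : ℝ) 1) : (1 - t) • v ∈ A := by
  exact hA.smul_mem hv (by linarith [ht.2]) (by linarith [ht.1])

/-- The simplex `x ↦ (1 - τ(x)) s(a(x))` in a star-shaped set: the simplex `s`, reparametrised by
`a`, at the time `τ` of the straight contraction to the origin. -/
def contractSimplex (hA : StarConvex ℝ 0 A) {k n : ℕ} (s : Simplex 𝓘(ℝ, V) A k)
    (a : (Fin n → ℝ) → Fin k → ℝ) (ha : ContDiff ℝ ∞ a) (ha' : MapsTo a (stdSolid n) (stdSolid k))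
    (τ : (Fin n → ℝ) → ℝ) (hτ : ContDiff ℝ ∞ τ) (hτ' : MapsTo τ (stdSolid n) (Icc 0 1)) :
    Simplex 𝓘(ℝ, V) A n where
  toFun x := ⟨(1 - τ x.1) • (s.toFun ⟨a x.1, ha' x.2⟩ : V),
    smul_mem_of_starConvex hA (s.toFun _).2 (hτ' x.2)⟩
  smooth' := by
    obtain ⟨g, hg, hg'⟩ := s.smooth'
    refine ⟨fun x => (1 - τ x) • g (a x), ?_, fun x => ?_⟩
    · rw [contMDiffOn_iff_contDiffOn] at hg ⊢
      exact (contDiff_const.sub hτ).contDiffOn.smul (hg.comp ha.contDiffOn ha')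
    · simp only [← hg' ⟨a x.1, ha' x.2⟩]

lemma simplex_ext {n : ℕ} {s t : Simplex 𝓘(ℝ, V) A n}
    (h : ∀ x, ((s.toFun x : A) : V) = (t.toFun x : A)) : s = t :=
  SMap.ext (funext fun x => Subtype.ext (h x))

lemma mem_stdSolid_one {x : Fin 1 → ℝ} : x ∈ stdSolid 1 ↔ 0 ≤ x 0 ∧ x 0 ≤ 1 := by
  simp [stdSolid]

lemma mem_stdSolid_two {x : Fin 2 → ℝ} :
    x ∈ stdSolid 2 ↔ 0 ≤ x 0 ∧ 0 ≤ x 1 ∧ x 0 + x 1 ≤ 1 := by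
  simp [stdSolid, Fin.forall_fin_two, and_assoc]

lemma mem_stdSolid_three {x : Fin 3 → ℝ} :
    x ∈ stdSolid 3 ↔ 0 ≤ x 0 ∧ 0 ≤ x 1 ∧ 0 ≤ x 2 ∧ x 0 + x 1 + x 2 ≤ 1 := by
  simp [stdSolid, Fin.forall_fin_succ, Fin.sum_univ_three, and_assoc]

/-- The triangle `[v₀, w₀, w₁]` of the square `Δ¹ × [0, 1]` under the contraction, where the vertices
`vᵢ` are at time `0` and the vertices `wᵢ` at time `1`. -/
def prismOneFst (hA : StarConvex ℝ 0 A) (s : Simplex 𝓘(ℝ, V) A 1) : Simplex 𝓘(ℝ, V) A 2 :=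
  contractSimplex hA s (fun x => ![x 1])
    (contDiff_pi.2 fun i => by fin_cases i; simpa using by fun_prop)
    (fun x hx => by
      rw [mem_stdSolid_two] at hx
      rw [mem_stdSolid_one]
      simp; constructor <;> linarith)
    (fun x => x 0 + x 1) (by fun_prop)
    (fun x hx => by rw [mem_stdSolid_two] at hx; constructor <;> linarith)

/-- The triangle `[v₀, v₁, w₁]` of the square `Δ¹ × [0, 1]` under the contraction. -/
def prismOneSnd (hA : StarConvex ℝ 0 A) (s : Simplex 𝓘(ℝ, V) A 1) : Simplex 𝓘(ℝ, V) A 2 :=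
  contractSimplex hA s (fun x => ![x 0 + x 1])
    (contDiff_pi.2 fun i => by fin_cases i; simpa using by fun_prop)
    (fun x hx => by
      rw [mem_stdSolid_two] at hx
      rw [mem_stdSolid_one]
      simp; constructor <;> linarith)
    (fun x => x 1) (by fun_prop)
    (fun x hx => by rw [mem_stdSolid_two] at hx; constructor <;> linarith)

/-- The tetrahedron `[v₀, w₀, w₁, w₂]` of the prism `Δ² × [0, 1]` under the contraction. -/
def prismTwoFst (hA : StarConvex ℝ 0 A) (s : Simplex 𝓘(ℝ, V) A 2) : Simplex 𝓘(ℝ, V) A 3 :=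
  contractSimplex hA s (fun x => ![x 1, x 2])
    (contDiff_pi.2 fun i => by fin_cases i <;> simpa using by fun_prop)
    (fun x hx => by
      rw [mem_stdSolid_three] at hx
      rw [mem_stdSolid_two]
      simp; refine ⟨?_, ?_, ?_⟩ <;> linarith)
    (fun x => x 0 + x 1 + x 2) (by fun_prop)
    (fun x hx => by rw [mem_stdSolid_three] at hx; constructor <;> linarith)

/-- The tetrahedron `[v₀, v₁, w₁, w₂]` of the prism `Δ² × [0, 1]` under the contraction. -/
def prismTwoSnd (hA : StarConvex ℝ 0 A) (s : Simplex 𝓘(ℝ, V) A 2) : Simplex 𝓘(ℝ, V) A 3 :=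
  contractSimplex hA s (fun x => ![x 0 + x 1, x 2])
    (contDiff_pi.2 fun i => by fin_cases i <;> simpa using by fun_prop)
    (fun x hx => by
      rw [mem_stdSolid_three] at hx
      rw [mem_stdSolid_two]
      simp; refine ⟨?_, ?_, ?_⟩ <;> linarith)
    (fun x => x 1 + x 2) (by fun_prop)
    (fun x hx => by rw [mem_stdSolid_three] at hx; constructor <;> linarith)

/-- The tetrahedron `[v₀, v₁, v₂, w₂]` of the prism `Δ² × [0, 1]` under the contraction. -/
def prismTwoTrd (hA : StarConvex ℝ 0 A) (s : Simplex 𝓘(ℝ, V) A 2) : Simplex 𝓘(ℝ, V) A 3 :=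
  contractSimplex hA s (fun x => ![x 0, x 1 + x 2])
    (contDiff_pi.2 fun i => by fin_cases i <;> simpa using by fun_prop)
    (fun x hx => by
      rw [mem_stdSolid_three] at hx
      rw [mem_stdSolid_two]
      simp; refine ⟨?_, ?_, ?_⟩ <;> linarith)
    (fun x => x 2) (by fun_prop)
    (fun x hx => by rw [mem_stdSolid_three] at hx; constructor <;> linarith)

/-- The prism operator on `1`-chains for the contraction of a star-shaped set to the origin. -/
def prismOne (hA : StarConvex ℝ 0 A) : Chain 𝓘(ℝ, V) A 1 →ₗ[ℤ] Chain 𝓘(ℝ, V) A 2 :=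
  Finsupp.linearCombination ℤ fun s =>
    Finsupp.single (prismOneFst hA s) 1 - Finsupp.single (prismOneSnd hA s) 1

/-- The prism operator on `2`-chains for the contraction of a star-shaped set to the origin. -/
def prismTwo (hA : StarConvex ℝ 0 A) : Chain 𝓘(ℝ, V) A 2 →ₗ[ℤ] Chain 𝓘(ℝ, V) A 3 :=
  Finsupp.linearCombination ℤ fun s =>
    Finsupp.single (prismTwoFst hA s) 1 - Finsupp.single (prismTwoSnd hA s) 1
      + Finsupp.single (prismTwoTrd hA s) 1

/-- The total multiplicity of a chain. -/
def augmentation (k : ℕ) : Chain 𝓘(ℝ, V) A k →ₗ[ℤ] ℤ := Finsupp.linearCombination ℤ fun _ => 1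

lemma augmentation_boundary_one (z : Chain 𝓘(ℝ, V) A 2) :
    augmentation 1 (boundary 1 z) = augmentation 2 z := by
  have : (augmentation 1).comp (boundary (I := 𝓘(ℝ, V)) (S := A) 1) = augmentation 2 := by
    refine Finsupp.lhom_ext' fun s => LinearMap.ext_ring ?_
    simp [augmentation, boundary_single]
  exact LinearMap.congr_fun this z

/-- The constant simplex at the origin. -/
def zeroSimplex (h0 : (0 : V) ∈ A) (n : ℕ) : Simplex 𝓘(ℝ, V) A n where
  toFun _ := ⟨0, h0⟩
  smooth' := ⟨fun _ => 0, contMDiffOn_const, fun _ => rfl⟩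

lemma faceFun_two_zero (x : Fin 2 → ℝ) :
    faceFun (k := 2) 0 x = ![1 - x 0 - x 1, x 0, x 1] := by
  ext j
  fin_cases j
  · simp [faceFun, bary, Fin.tail, sub_sub]
  · simp only [faceFun, bary, Fin.tail, Fin.insertNth_zero]
    rfl
  · simp only [faceFun, bary, Fin.tail, Fin.insertNth_zero]
    rfl

lemma faceFun_two_one (x : Fin 2 → ℝ) : faceFun (k := 2) 1 x = ![0, x 0, x 1] := by
  ext j
  fin_cases j
  · exact Fin.insertNth_apply_same (α := fun _ => ℝ) (1 : Fin 4) 0 (bary x)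
  · exact Fin.insertNth_apply_succAbove (α := fun _ => ℝ) (1 : Fin 4) 0 (bary x) 1
  · exact Fin.insertNth_apply_succAbove (α := fun _ => ℝ) (1 : Fin 4) 0 (bary x) 2

lemma faceFun_two_two (x : Fin 2 → ℝ) : faceFun (k := 2) 2 x = ![x 0, 0, x 1] := by
  ext j
  fin_cases j
  · exact Fin.insertNth_apply_succAbove (α := fun _ => ℝ) (2 : Fin 4) 0 (bary x) 1
  · exact Fin.insertNth_apply_same (α := fun _ => ℝ) (2 : Fin 4) 0 (bary x)
  · exact Fin.insertNth_apply_succAbove (α := fun _ => ℝ) (2 : Fin 4) 0 (bary x) 2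

lemma faceFun_two_three (x : Fin 2 → ℝ) : faceFun (k := 2) 3 x = ![x 0, x 1, 0] := by
  ext j
  fin_cases j
  · exact Fin.insertNth_apply_succAbove (α := fun _ => ℝ) (3 : Fin 4) 0 (bary x) 1
  · exact Fin.insertNth_apply_succAbove (α := fun _ => ℝ) (3 : Fin 4) 0 (bary x) 2
  · exact Fin.insertNth_apply_same (α := fun _ => ℝ) (3 : Fin 4) 0 (bary x)

lemma boundary_two_single (s : Simplex 𝓘(ℝ, V) A 3) :
    boundary 2 (Finsupp.single s 1) = Finsupp.single (s.comp (faceMap 0)) 1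
      - Finsupp.single (s.comp (faceMap 1)) 1 + Finsupp.single (s.comp (faceMap 2)) 1
      - Finsupp.single (s.comp (faceMap 3)) 1 := by
  simp [boundary, Finsupp.linearCombination_single, Fin.sum_univ_succ, sub_eq_add_neg, add_assoc]

lemma boundary_prismTwo_single (hA : StarConvex ℝ 0 A) (h0 : (0 : V) ∈ A)
    (s : Simplex 𝓘(ℝ, V) A 2) :
    boundary 2 (prismTwo hA (Finsupp.single s 1)) + prismOne hA (boundary 1 (Finsupp.single s 1)) =
      Finsupp.single (zeroSimplex h0 2) 1 - Finsupp.single s 1 := by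
  -- the collapsed lid and the untouched floor of the prism
  have top : (prismTwoFst hA s).comp (faceMap 0) = zeroSimplex h0 2 := simplex_ext fun x => by
    have e : 1 - x.1 0 - x.1 1 + x.1 0 + x.1 1 = 1 := by ring
    simp [prismTwoFst, SMap.comp, contractSimplex, faceMap, faceFun_two_zero, zeroSimplex, e]
  have bot : (prismTwoTrd hA s).comp (faceMap 3) = s := simplex_ext fun x => by
    have e : ![x.1 0, x.1 1] = x.1 := by ext i; fin_cases i <;> rfl
    simp [prismTwoTrd, SMap.comp, contractSimplex, faceMap, faceFun_two_three, e]
  -- the two triangles along which neighbouring tetrahedra meet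
  have i₁ : (prismTwoFst hA s).comp (faceMap 1) = (prismTwoSnd hA s).comp (faceMap 1) :=
    simplex_ext fun x => by
      simp [prismTwoFst, prismTwoSnd, SMap.comp, contractSimplex, faceMap, faceFun_two_one]
  have i₂ : (prismTwoSnd hA s).comp (faceMap 2) = (prismTwoTrd hA s).comp (faceMap 2) :=
    simplex_ext fun x => by
      simp [prismTwoSnd, prismTwoTrd, SMap.comp, contractSimplex, faceMap, faceFun_two_two]
  -- the six triangles of the three sides
  have a₂ : (prismTwoFst hA s).comp (faceMap 2) = prismOneFst hA (s.comp (faceMap 1)) :=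
    simplex_ext fun x => by
      simp [prismTwoFst, prismOneFst, SMap.comp, contractSimplex, faceMap, faceFun_two_two,
        faceFun_one]
  have a₃ : (prismTwoFst hA s).comp (faceMap 3) = prismOneFst hA (s.comp (faceMap 2)) :=
    simplex_ext fun x => by
      simp [prismTwoFst, prismOneFst, SMap.comp, contractSimplex, faceMap, faceFun_two_three,
        faceFun_two]
  have b₀ : (prismTwoSnd hA s).comp (faceMap 0) = prismOneFst hA (s.comp (faceMap 0)) :=
    simplex_ext fun x => by
      have e : 1 - x.1 0 - x.1 1 + x.1 0 = 1 - x.1 1 := by ring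
      simp [prismTwoSnd, prismOneFst, SMap.comp, contractSimplex, faceMap, faceFun_two_zero,
        faceFun_zero, e]
  have b₃ : (prismTwoSnd hA s).comp (faceMap 3) = prismOneSnd hA (s.comp (faceMap 2)) :=
    simplex_ext fun x => by
      simp [prismTwoSnd, prismOneSnd, SMap.comp, contractSimplex, faceMap, faceFun_two_three,
        faceFun_two]
  have c₀ : (prismTwoTrd hA s).comp (faceMap 0) = prismOneSnd hA (s.comp (faceMap 0)) :=
    simplex_ext fun x => by
      simp [prismTwoTrd, prismOneSnd, SMap.comp, contractSimplex, faceMap, faceFun_two_zero,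
        faceFun_zero, sub_sub]
  have c₁ : (prismTwoTrd hA s).comp (faceMap 1) = prismOneSnd hA (s.comp (faceMap 1)) :=
    simplex_ext fun x => by
      simp [prismTwoTrd, prismOneSnd, SMap.comp, contractSimplex, faceMap, faceFun_two_one,
        faceFun_one]
  simp only [prismTwo, prismOne, boundary_single, map_add, map_sub, one_smul,
    Finsupp.linearCombination_single, boundary_two_single]
  rw [top, bot, i₁, i₂, a₂, a₃, b₀, b₃, c₀, c₁]
  abel

/-- The prism operators are a chain homotopy from the identity to the collapse onto the origin. -/
lemma boundary_prismTwo (hA : StarConvex ℝ 0 A) (h0 : (0 : V) ∈ A) (z : Chain 𝓘(ℝ, V) A 2) :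
    boundary 2 (prismTwo hA z) + prismOne hA (boundary 1 z) =
      augmentation 2 z • Finsupp.single (zeroSimplex h0 2) 1 - z := by
  have : (boundary 2).comp (prismTwo hA) + (prismOne hA).comp (boundary 1) =
      (augmentation 2).smulRight (Finsupp.single (zeroSimplex h0 2) (1 : ℤ)) - LinearMap.id := by
    refine Finsupp.lhom_ext' fun s => LinearMap.ext_ring ?_
    simpa [augmentation] using boundary_prismTwo_single hA h0 s
  exact LinearMap.congr_fun this z

/-- In a star-shaped set every smooth `2`-cycle bounds. The collapse of a cycle onto the origin is
zero because its multiplicity is that of its boundary. -/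
lemma mem_range_boundary_of_cycle (hA : StarConvex ℝ 0 A) (h0 : (0 : V) ∈ A)
    (z : Chain 𝓘(ℝ, V) A 2) (hz : boundary 1 z = 0) :
    z ∈ LinearMap.range (boundary (I := 𝓘(ℝ, V)) (S := A) 2) := by
  have h := boundary_prismTwo hA h0 z
  rw [← augmentation_boundary_one, hz, map_zero, map_zero, zero_smul, add_zero, zero_sub] at h
  exact ⟨-prismTwo hA z, by rw [map_neg, h, neg_neg]⟩

end Prism

/-! ### Smooth discs bounded by loops -/

section Filling

open Filter Topology

variable {m : ℕ} {X : Type*} [TopologicalSpace X] [ChartedSpace (EuclideanSpace ℝ (Fin m)) X]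

/-- Smoothing in one chart. A continuous map that sends a closed ball into a chart can be changed
inside the ball such that it becomes smooth on a smaller ball and stays smooth where it was, and
such that it still sends given compact sets into given open sets. -/
lemma exists_smooth_modification [IsManifold (𝓡 m) ∞ X] {f : ℂ → X} (hf : Continuous f) (x : X)
    {c : ℂ} {r R : ℝ} (hr : 0 < r) (hrR : r < R)
    (hU : MapsTo f (closedBall c R) (extChartAt (𝓡 m) x).source) {W : Set ℂ} (hW : IsOpen W)
    (hfW : ContMDiffOn 𝓘(ℝ, ℂ) (𝓡 m) ∞ f W) {ι : Type*} [Finite ι] (K : ι → Set ℂ)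
    (hK : ∀ i, IsCompact (K i)) (O : ι → Set X) (hO : ∀ i, IsOpen (O i))
    (hKO : ∀ i, MapsTo f (K i) (O i)) :
    ∃ f' : ℂ → X, Continuous f' ∧ ContMDiffOn 𝓘(ℝ, ℂ) (𝓡 m) ∞ f' (W ∪ ball c r) ∧
      EqOn f' f (ball c R)ᶜ ∧ ∀ i, MapsTo f' (K i) (O i) := by
  set φ := extChartAt (𝓡 m) x with hφ
  have hφc : ContinuousOn φ φ.source := continuousOn_extChartAt x
  have hφs : IsOpen φ.source := isOpen_extChartAt_source x
  have hφt : IsOpen φ.target := isOpen_extChartAt_target x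
  have hψc : ContinuousOn φ.symm φ.target := continuousOn_extChartAt_symm x
  have hφm : ContMDiffOn (𝓡 m) 𝓘(ℝ, EuclideanSpace ℝ (Fin m)) ∞ φ φ.source := by
    rw [hφ, extChartAt_source]; exact contMDiffOn_extChartAt
  have hψm : ContMDiffOn 𝓘(ℝ, EuclideanSpace ℝ (Fin m)) (𝓡 m) ∞ φ.symm φ.target :=
    contMDiffOn_extChartAt_symm x
  have hB : IsCompact (closedBall c R) := isCompact_closedBall c R
  have hφf : ContinuousOn (fun z => φ (f z)) (closedBall c R) :=
    hφc.comp hf.continuousOn hU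
  -- a distance `δ` by which the map may move in the chart
  have hδ₁ : ∀ᶠ δ in 𝓝[>] (0 : ℝ),
      thickening δ ((fun z => φ (f z)) '' closedBall c R) ⊆ φ.target := by
    obtain ⟨δ, hδ, h⟩ := (hB.image_of_continuousOn hφf).exists_thickening_subset_open hφt
      (image_subset_iff.2 fun z hz => φ.map_source (hU hz))
    filter_upwards [Ioo_mem_nhdsGT hδ] with ε hε
    exact (thickening_mono hε.2.le _).trans h
  have hδ₂ : ∀ᶠ δ in 𝓝[>] (0 : ℝ), ∀ i,
      thickening δ ((fun z => φ (f z)) '' (closedBall c R ∩ K i)) ⊆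
        φ.target ∩ φ.symm ⁻¹' O i := by
    rw [eventually_all]
    intro i
    obtain ⟨δ, hδ, h⟩ := ((hB.inter (hK i)).image_of_continuousOn
      (hφf.mono inter_subset_left)).exists_thickening_subset_open
      (hψc.isOpen_inter_preimage hφt (hO i))
      (image_subset_iff.2 fun z hz => ⟨φ.map_source (hU hz.1), by
        rw [mem_preimage, φ.left_inv (hU hz.1)]; exact hKO i hz.2⟩)
    filter_upwards [Ioo_mem_nhdsGT hδ] with ε hε
    exact (thickening_mono hε.2.le _).trans h
  obtain ⟨δ, hδ₁, hδ₂, hδ⟩ := (hδ₁.and (hδ₂.and self_mem_nhdsWithin)).exists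
  replace hδ : 0 < δ := hδ
  -- a smooth approximation in the chart
  obtain ⟨g₀, hg₀⟩ := ContinuousMap.exists_restrict_eq (isClosed_closedBall (x := c) (ε := R))
    (⟨_, hφf.domRestrict⟩ : C(closedBall c R, EuclideanSpace ℝ (Fin m)))
  obtain ⟨g, hg, -⟩ := g₀.continuous.exists_contMDiff_approx 𝓘(ℝ, ℂ) ⊤
    (ε := fun _ => δ) continuous_const fun _ => hδ
  have hgf : ∀ z ∈ closedBall c R, dist (g z) (φ (f z)) < δ := fun z hz => by
    have := congr($hg₀ ⟨z, hz⟩)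
    simp only [ContinuousMap.restrict_apply, ContinuousMap.coe_mk, domRestrict_apply] at this
    rw [← this]
    exact hg z
  let ρ : ContDiffBump c := ⟨r, R, hr, hrR⟩
  let u : ℂ → EuclideanSpace ℝ (Fin m) := fun z => φ (f z) + ρ z • (g z - φ (f z))
  have hρ0 : ∀ z ∉ ball c R, ρ z = 0 := fun z hz =>
    ρ.zero_of_le_dist (not_lt.1 hz)
  have hu0 : ∀ z ∉ ball c R, u z = φ (f z) := fun z hz => by simp [u, hρ0 z hz]
  have hud : ∀ z ∈ closedBall c R, dist (u z) (φ (f z)) < δ := fun z hz => by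
    rw [dist_eq_norm, add_sub_cancel_left, norm_smul, Real.norm_of_nonneg ρ.nonneg]
    refine lt_of_le_of_lt (mul_le_of_le_one_left (norm_nonneg _) ρ.le_one) ?_
    rw [← dist_eq_norm]
    exact hgf z hz
  have hut : ∀ z ∈ f ⁻¹' φ.source, u z ∈ φ.target := fun z hz => by
    by_cases h : z ∈ ball c R
    · exact hδ₁ (mem_thickening_iff.2 ⟨_, mem_image_of_mem _ (ball_subset_closedBall h),
        hud z (ball_subset_closedBall h)⟩)
    · rw [hu0 z h]; exact φ.map_source hz
  have hS : IsOpen (f ⁻¹' φ.source) := hφs.preimage hf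
  classical
  -- the two descriptions of `f'` agree where both apply, and each holds on one of the open sets
  -- `f ⁻¹' φ.source` and `(closedBall c R)ᶜ`, which cover the plane
  let f' : ℂ → X := fun z => if z ∈ f ⁻¹' φ.source then φ.symm (u z) else f z
  have hf'S : EqOn f' (fun z => φ.symm (u z)) (f ⁻¹' φ.source) := fun z hz => if_pos hz
  have hf'R : EqOn f' f (ball c R)ᶜ := fun z hz => by
    by_cases h : z ∈ f ⁻¹' φ.source
    · rw [hf'S h]; simp only [hu0 z hz]; exact φ.left_inv h
    · exact if_neg h
  have hf'O : ∀ z ∉ f ⁻¹' φ.source, f' =ᶠ[𝓝 z] f := fun z hz =>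
    hf'R.eventuallyEq_of_mem (mem_of_superset
      (isClosed_closedBall.isOpen_compl.mem_nhds fun h => hz (hU h))
      (compl_subset_compl.2 ball_subset_closedBall))
  have huc : ContinuousOn u (f ⁻¹' φ.source) := by
    have h := hφc.comp hf.continuousOn (mapsTo_preimage f φ.source)
    exact h.add (ρ.continuous.continuousOn.smul (g.contMDiff.continuous.continuousOn.sub h))
  refine ⟨f', continuous_iff_continuousAt.2 fun z => ?_, ?_, hf'R, fun i z hz => ?_⟩
  · by_cases h : z ∈ f ⁻¹' φ.source
    · exact ((hψc.comp huc hut).congr hf'S).continuousAt (hS.mem_nhds h)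
    · exact hf.continuousAt.congr (hf'O z h).symm
  · have hfb : ball c R ⊆ f ⁻¹' φ.source := fun z hz => hU (ball_subset_closedBall hz)
    have key : ∀ z ∈ f ⁻¹' φ.source, ContMDiffAt 𝓘(ℝ, ℂ) 𝓘(ℝ, EuclideanSpace ℝ (Fin m)) ∞ u z →
        ContMDiffAt 𝓘(ℝ, ℂ) (𝓡 m) ∞ f' z := fun z hz h =>
      ((hψm.contMDiffAt (hφt.mem_nhds (hut z hz))).comp z h).congr_of_eventuallyEq
        (hf'S.eventuallyEq_of_mem (hS.mem_nhds hz))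
    rintro z (hz | hz)
    · refine ContMDiffAt.contMDiffWithinAt ?_
      have hfz := hfW.contMDiffAt (hW.mem_nhds hz)
      by_cases h : z ∈ f ⁻¹' φ.source
      · refine key z h ?_
        have h₁ : ContMDiffAt 𝓘(ℝ, ℂ) 𝓘(ℝ, EuclideanSpace ℝ (Fin m)) ∞ (fun z => φ (f z)) z :=
          (hφm.contMDiffAt (hφs.mem_nhds h)).comp z hfz
        exact h₁.add (ρ.contDiff.contMDiff.contMDiffAt.smul (g.contMDiff.contMDiffAt.sub h₁))
      · exact hfz.congr_of_eventuallyEq (hf'O z h)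
    · refine (key z (hfb (ball_subset_ball hrR.le hz)) ?_).contMDiffWithinAt
      refine g.contMDiff.contMDiffAt.congr_of_eventuallyEq ?_
      filter_upwards [isOpen_ball.mem_nhds hz] with w hw
      simp [u, ρ.one_of_mem_closedBall (ball_subset_closedBall hw)]
  · by_cases h : z ∈ ball c R
    · have h' := ball_subset_closedBall h
      rw [hf'S (hU h')]
      exact (hδ₂ i (mem_thickening_iff.2 ⟨_, mem_image_of_mem _ ⟨h', hz⟩, hud z h'⟩)).2
    · rw [hf'R h]; exact hKO i hz

/-- A continuous map on the plane that is smooth off a disc can be made smooth by a change inside any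
larger concentric disc: finitely many modifications in charts suffice. -/
lemma exists_contMDiff_eqOn_compl_ball [IsManifold (𝓡 m) ∞ X] {f : ℂ → X} (hf : Continuous f)
    {a b : ℝ} (hab : a < b)
    (hfs : ContMDiffOn 𝓘(ℝ, ℂ) (𝓡 m) ∞ f (closedBall 0 a)ᶜ) :
    ∃ f' : ℂ → X, ContMDiff 𝓘(ℝ, ℂ) (𝓡 m) ∞ f' ∧ EqOn f' f (ball 0 b)ᶜ := by
  have hloc : ∀ z ∈ closedBall (0 : ℂ) a, ∃ R > 0, closedBall z R ⊆
      f ⁻¹' (extChartAt (𝓡 m) (f z)).source ∩ ball 0 b := fun z hz =>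
    nhds_basis_closedBall.mem_iff.1 (inter_mem
      (((isOpen_extChartAt_source (f z)).preimage hf).mem_nhds (mem_extChartAt_source (f z)))
      (isOpen_ball.mem_nhds (closedBall_subset_ball hab hz)))
  choose! R hR hRs using hloc
  obtain ⟨t, ht, htc⟩ := (isCompact_closedBall (0 : ℂ) a).elim_nhds_subcover
    (fun z => ball z (R z / 2)) fun z hz => ball_mem_nhds z (half_pos (hR z hz))
  have key : ∀ s ⊆ t, ∃ f' : ℂ → X, Continuous f' ∧
      ContMDiffOn 𝓘(ℝ, ℂ) (𝓡 m) ∞ f' ((closedBall 0 a)ᶜ ∪ ⋃ z ∈ s, ball z (R z / 2)) ∧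
      EqOn f' f (ball 0 b)ᶜ ∧
      ∀ z : t, MapsTo f' (closedBall z (R z)) (extChartAt (𝓡 m) (f z)).source := by
    intro s
    induction s using Finset.induction_on with
    | empty =>
      exact fun _ => ⟨f, hf, by simpa using hfs, fun _ _ => rfl,
        fun z w hw => (hRs z (ht z z.2) hw).1⟩
    | insert c s hc ih =>
      intro hs
      obtain ⟨f₁, h₁, h₂, h₃, h₄⟩ := ih ((Finset.subset_insert c s).trans hs)
      have hct : c ∈ t := hs (Finset.mem_insert_self c s)
      have hRc := hR c (ht c hct)
      obtain ⟨f₂, g₁, g₂, g₃, g₄⟩ := exists_smooth_modification h₁ (f c) (half_pos hRc)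
        (half_lt_self hRc) (h₄ ⟨c, hct⟩)
        (isClosed_closedBall.isOpen_compl.union (isOpen_biUnion fun _ _ => isOpen_ball)) h₂
        (fun z : t => closedBall (z : ℂ) (R z)) (fun z => isCompact_closedBall _ _)
        (fun z => (extChartAt (𝓡 m) (f z)).source) (fun z => isOpen_extChartAt_source _) h₄
      refine ⟨f₂, g₁, g₂.mono ?_, fun z hz => ?_, g₄⟩
      · rw [Finset.set_biUnion_insert, union_comm (ball c _), union_assoc]
        rfl
      · rw [g₃ fun h => hz (hRs c (ht c hct) (ball_subset_closedBall h)).2, h₃ hz]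
  obtain ⟨f', -, h₂, h₃, -⟩ := key t subset_rfl
  refine ⟨f', contMDiffOn_univ.1 (h₂.mono fun z _ => ?_), h₃⟩
  by_cases hz : z ∈ closedBall (0 : ℂ) a
  · exact Or.inr (htc hz)
  · exact Or.inl hz

lemma exists_circleExp_two_pi_eq (θ : ℝ) :
    ∃ t : unitInterval, Circle.exp (2 * Real.pi * t) = Circle.exp θ := by
  refine ⟨⟨Int.fract (θ / (2 * Real.pi)), Int.fract_nonneg _, (Int.fract_lt_one _).le⟩,
    Circle.exp_eq_exp.2 ⟨-⌊θ / (2 * Real.pi)⌋, ?_⟩⟩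
  have := Real.pi_pos
  simp only [Int.fract]
  push_cast
  field_simp
  ring

/-- A continuous loop in a simply connected space extends to the plane, constantly along the rays
off a smaller disc. -/
lemma exists_continuous_extension {X : Type*} [TopologicalSpace X] [SimplyConnectedSpace X]
    {γ : Circle → X} (hγ : Continuous γ) :
    ∃ F : ℂ → X, Continuous F ∧ ∀ z : ℂ, 1 / 2 ≤ ‖z‖ → F z = γ (Circle.exp z.arg) := by
  let p : Path (γ 1) (γ 1) :=
    { toFun := fun t => γ (Circle.exp (2 * Real.pi * t))
      continuous_toFun := by fun_prop
      source' := by simp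
      target' := by simp }
  obtain ⟨H⟩ := SimplyConnectedSpace.paths_homotopic (Path.refl (γ 1)) p
  -- polar coordinates are a quotient map, and the homotopy descends along them
  have hmem : ∀ x : unitInterval × unitInterval,
      ((x.1 : ℝ) * (Circle.exp (2 * Real.pi * x.2) : ℂ) : ℂ) ∈ closedBall (0 : ℂ) 1 := fun x => by
    rw [mem_closedBall_zero_iff, norm_mul, Circle.norm_coe, mul_one, Complex.norm_real,
      Real.norm_of_nonneg x.1.2.1]
    exact x.1.2.2
  let q : C(unitInterval × unitInterval, closedBall (0 : ℂ) 1) :=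
    ⟨fun x => ⟨_, hmem x⟩, Continuous.subtype_mk (by fun_prop) hmem⟩
  have hnorm : ∀ x, ‖(q x : ℂ)‖ = x.1 := fun x => by
    change ‖(x.1 : ℝ) * (Circle.exp (2 * Real.pi * x.2) : ℂ)‖ = x.1
    rw [norm_mul, Circle.norm_coe, mul_one, Complex.norm_real, Real.norm_of_nonneg x.1.2.1]
  have hqs : Function.Surjective q := by
    rintro ⟨z, hz⟩
    obtain ⟨t, ht⟩ := exists_circleExp_two_pi_eq z.arg
    refine ⟨(⟨‖z‖, norm_nonneg z, by simpa using hz⟩, t), Subtype.ext ?_⟩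
    change (‖z‖ : ℂ) * (Circle.exp (2 * Real.pi * t) : ℂ) = z
    rw [ht, Circle.coe_exp, Complex.norm_mul_exp_arg_mul_I]
  have hqq := Topology.IsQuotientMap.of_surjective_continuous hqs q.continuous
  let G : C(unitInterval × unitInterval, X) :=
    ⟨fun x => H (⟨min 1 (2 * (x.1 : ℝ)),
      le_min zero_le_one (by linarith [x.1.2.1]), min_le_left _ _⟩, x.2), by fun_prop⟩
  have hG : Function.FactorsThrough G q := by
    -- at radius `0` the homotopy is still constant, so the angle does not matter
    rintro ⟨r, t⟩ ⟨r', t'⟩ h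
    obtain rfl : r = r' := by
      have h₁ := hnorm (r, t)
      rw [h, hnorm] at h₁
      exact Subtype.ext h₁.symm
    by_cases hr : (r : ℝ) = 0
    · have e : (⟨min 1 (2 * (r : ℝ)), le_min zero_le_one (by linarith [r.2.1]), min_le_left _ _⟩ :
          unitInterval) = 0 := Subtype.ext (by simp [hr])
      change H (_, t) = H (_, t')
      rw [e, H.apply_zero, H.apply_zero]
      rfl
    · have h₁ : Circle.exp (2 * Real.pi * t) = Circle.exp (2 * Real.pi * t') := Subtype.ext <|
        mul_left_cancel₀ (Complex.ofReal_ne_zero.2 hr) (congrArg Subtype.val h)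
      obtain ⟨n, hn⟩ := Circle.exp_eq_exp.1 h₁
      have hn' : (t : ℝ) = t' + n := by
        have := Real.pi_pos
        have h₂ : (2 * Real.pi) * (t : ℝ) = (2 * Real.pi) * (t' + n) := by rw [hn]; ring
        exact mul_left_cancel₀ (by positivity) h₂
      have b₁ : (-1 : ℤ) ≤ n := by
        have : (-1 : ℝ) ≤ n := by linarith [t.2.1, t'.2.2]
        exact_mod_cast this
      have b₂ : n ≤ 1 := by
        have : (n : ℝ) ≤ 1 := by linarith [t.2.2, t'.2.1]
        exact_mod_cast this
      change H (_, t) = H (_, t')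
      -- the angles agree, or they are the two ends of the interval, where the homotopy is fixed
      have hcases : n = -1 ∨ n = 0 ∨ n = 1 := by omega
      rcases hcases with rfl | rfl | rfl
      · push_cast at hn'
        obtain rfl : t = 0 := Subtype.ext (by
          have := t.2.1; have := t'.2.2; simp only [Set.Icc.coe_zero]; linarith)
        obtain rfl : t' = 1 := Subtype.ext (by
          simp only [Set.Icc.coe_zero] at hn'; simp only [Set.Icc.coe_one]; linarith)
        rw [H.source, H.target]
      · obtain rfl : t = t' := Subtype.ext (by simpa using hn')
        rfl
      · push_cast at hn'
        obtain rfl : t' = 0 := Subtype.ext (by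
          have := t.2.2; have := t'.2.1; simp only [Set.Icc.coe_zero]; linarith)
        obtain rfl : t = 1 := Subtype.ext (by
          simp only [Set.Icc.coe_zero] at hn'; simp only [Set.Icc.coe_one]; linarith)
        rw [H.source, H.target]
  let F₀ : C(closedBall (0 : ℂ) 1, X) := hqq.lift G hG
  have hF₀ : ∀ x, F₀ (q x) = G x := fun x => congr($(hqq.lift_comp G hG) x)
  -- the extension from the closed disc to the plane, by the radial retraction
  have hmax : ∀ z : ℂ, 0 < max 1 ‖z‖ := fun z => lt_max_of_lt_left one_pos
  let ν : ℂ → closedBall (0 : ℂ) 1 := fun z => ⟨z / (max 1 ‖z‖ : ℝ), by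
    rw [mem_closedBall_zero_iff, norm_div, Complex.norm_real, Real.norm_of_nonneg (hmax z).le]
    exact div_le_one_of_le₀ (le_max_right _ _) (hmax z).le⟩
  have hν : Continuous ν := Continuous.subtype_mk (continuous_id.div (by fun_prop)
    fun z => Complex.ofReal_ne_zero.2 (hmax z).ne') _
  refine ⟨fun z => F₀ (ν z), F₀.continuous.comp hν, fun z hz => ?_⟩
  obtain ⟨t, ht⟩ := exists_circleExp_two_pi_eq z.arg
  let r : unitInterval := ⟨‖z‖ / max 1 ‖z‖, by have := hmax z; positivity,
    div_le_one_of_le₀ (le_max_right _ _) (hmax z).le⟩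
  have hr : 1 ≤ 2 * (r : ℝ) := by
    have : 1 / 2 ≤ ‖z‖ / max 1 ‖z‖ := by
      rw [le_div_iff₀ (hmax z)]
      rcases max_cases 1 ‖z‖ with h | h <;> rw [h.1] <;> linarith
    linarith [show (r : ℝ) = ‖z‖ / max 1 ‖z‖ from rfl]
  have hz' : ν z = q (r, t) := Subtype.ext <| by
    change z / (max 1 ‖z‖ : ℝ) =
      ((‖z‖ / max 1 ‖z‖ : ℝ) : ℂ) * (Circle.exp (2 * Real.pi * t) : ℂ)
    rw [ht, Circle.coe_exp, Complex.ofReal_div, div_mul_eq_mul_div,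
      Complex.norm_mul_exp_arg_mul_I]
  have e : (⟨min 1 (2 * (r : ℝ)), le_min zero_le_one (by linarith [r.2.1]), min_le_left _ _⟩ :
      unitInterval) = 1 := Subtype.ext (min_eq_left hr)
  change F₀ (ν z) = _
  rw [hz', hF₀]
  change H (_, t) = _
  rw [e, H.apply_one, ← ht]
  rfl

lemma circleExp_arg_neg {z : ℂ} (hz : z ≠ 0) :
    Circle.exp ((-z).arg + Real.pi) = Circle.exp z.arg := by
  refine Subtype.ext (mul_left_cancel₀ (Complex.ofReal_ne_zero.2 (norm_ne_zero_iff.2 hz)) ?_)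
  rw [Circle.exp_add, Circle.coe_mul, Circle.coe_exp, Circle.coe_exp, Circle.coe_exp,
    Complex.norm_mul_exp_arg_mul_I, Complex.exp_pi_mul_I, ← mul_assoc, ← norm_neg z,
    Complex.norm_mul_exp_arg_mul_I, mul_neg_one, neg_neg]

lemma contDiffAt_arg {z : ℂ} (hz : z ∈ Complex.slitPlane) : ContDiffAt ℝ ∞ Complex.arg z := by
  have h : Complex.arg = Complex.imCLM ∘ Complex.log := funext fun w => (Complex.log_im w).symm
  rw [h]
  exact Complex.imCLM.contDiff.contDiffAt.comp z ((Complex.contDiffAt_log hz).restrict_scalars ℝ)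

/-- The angular coordinate is a smooth map to the circle. Across the cut of the argument, it is the
angular coordinate of the opposite point, turned by `π`. -/
lemma contMDiffAt_circleExp_arg {z : ℂ} (hz : z ≠ 0) :
    ContMDiffAt 𝓘(ℝ, ℂ) (𝓡 1) ∞ (fun z : ℂ => Circle.exp z.arg) z := by
  by_cases h : z ∈ Complex.slitPlane
  · exact contMDiff_circleExp.contMDiffAt.comp z (contDiffAt_arg h).contMDiffAt
  · have h' : -z ∈ Complex.slitPlane := by
      rw [Complex.mem_slitPlane_iff, not_or, not_lt, not_not] at h
      refine Or.inl ?_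
      rw [Complex.neg_re, neg_pos]
      exact lt_of_le_of_ne h.1 fun h0 => hz (Complex.ext h0 h.2)
    have hs : ContDiffAt ℝ ∞ (fun w : ℂ => (-w).arg + Real.pi) z :=
      ((contDiffAt_arg h').comp z contDiffAt_id.neg).add contDiffAt_const
    refine (contMDiff_circleExp.contMDiffAt.comp z hs.contMDiffAt).congr_of_eventuallyEq ?_
    filter_upwards [isOpen_ne.mem_nhds hz] with w hw
    exact (circleExp_arg_neg hw).symm

/-- Every smooth loop in a simply connected manifold bounds a smooth disc. -/
lemma exists_discMap_bdry_eq [IsManifold (𝓡 m) ∞ X] [SimplyConnectedSpace X]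
    (γ : LoopSpace m X) : ∃ σ : DiscMap m X, DiscMap.bdry σ = γ := by
  obtain ⟨F, hF, hFγ⟩ := exists_continuous_extension γ.contMDiff.continuous
  obtain ⟨f, hf, hfF⟩ := exists_contMDiff_eqOn_compl_ball (m := m) hF
    (one_half_lt_one (α := ℝ)) fun z hz => by
    have hz' : 1 / 2 < ‖z‖ := by simpa using hz
    have h0 : z ≠ 0 := fun h => by rw [h, norm_zero] at hz'; norm_num at hz'
    refine ContMDiffAt.contMDiffWithinAt ?_
    refine (γ.contMDiff.contMDiffAt.comp z (contMDiffAt_circleExp_arg h0)).congr_of_eventuallyEq ?_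
    filter_upwards [isClosed_closedBall.isOpen_compl.mem_nhds hz] with w hw
    have : 1 / 2 < ‖w‖ := by simpa using hw
    exact hFγ w this.le
  refine ⟨⟨fun z => ⟨f z, mem_univ _⟩, f, hf.contMDiffOn, fun _ => rfl⟩, ?_⟩
  ext z
  have hz : (z : ℂ) ∈ (ball (0 : ℂ) 1)ᶜ := by simp [Circle.norm_coe]
  change f z = γ z
  rw [hfF hz, hFγ _ (by rw [Circle.norm_coe]; norm_num), Circle.exp_arg]

end Filling

/-! ### The section of the pulled-back line bundle -/

section Section

variable {m : ℕ} {X : Type*} [TopologicalSpace X] [ChartedSpace (EuclideanSpace ℝ (Fin m)) X]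
  {S : Type*} [TopologicalSpace S] [ChartedSpace (EuclideanHalfSpace 2) S]

lemma DiffCharacter.val_ne_zero (ξ : DiffCharacter m X) (z : Cycles2 m X) : ξ.val z ≠ 0 :=
  Circle.coe_ne_zero _

/-- The number `h(σ # ν)` does not depend on the fundamental chains: those of the disc differ by a
boundary because the disc is star-shaped, and boundaries in a surface do not contribute. -/
lemma val_glueSurface_eq (ξ : DiffCharacter m X) {β : BoundaryCircle S}
    {d d' : FundChain discBdry} {c c' : SurfaceFund β}
    (hc : c'.chain - c.chain ∈ LinearMap.range (boundary 2)) (p : FibreProduct m X β) :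
    ξ.val (glueSurface d' c' p) = ξ.val (glueSurface d c p) := by
  obtain ⟨μ, hμ⟩ := hc
  obtain ⟨μ', hμ'⟩ := mem_range_boundary_of_cycle
    ((convex_closedBall (0 : ℂ) 1).starConvex (mem_closedBall_self zero_le_one))
    (mem_closedBall_self zero_le_one) (d'.chain - d.chain)
    (by rw [map_sub, d'.boundary_eq, d.boundary_eq, sub_self])
  let u : Cycles2 m X := ⟨push p.1.1 2 (boundary 2 μ'), by
    rw [LinearMap.mem_ker, boundary_push, hμ', map_sub, d'.boundary_eq, d.boundary_eq, sub_self,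
      map_zero]⟩
  let v : Cycles2 m X := ⟨push (SMap.ofSmooth p.1.2) 2 (boundary 2 μ), by
    rw [LinearMap.mem_ker, boundary_push, hμ, map_sub, c'.boundary_eq, c.boundary_eq, sub_self,
      map_zero]⟩
  have hu : ξ.val u = 1 := ξ.val_push_boundary (by simp) _ μ' u rfl
  have hv : ξ.val v = 1 := ξ.val_push_boundary (by simp) _ μ v rfl
  have h : glueSurface d' c' p + v = glueSurface d c p + u := Subtype.ext <| by
    change push p.1.1 2 d'.chain - push (SMap.ofSmooth p.1.2) 2 c'.chain
        + push (SMap.ofSmooth p.1.2) 2 (boundary 2 μ) =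
      push p.1.1 2 d.chain - push (SMap.ofSmooth p.1.2) 2 c.chain
        + push p.1.1 2 (boundary 2 μ')
    rw [hμ, hμ', map_sub, map_sub]
    abel
  simpa [ξ.val_add, hu, hv] using congrArg ξ.val h

lemma isSectionRule_canonicalFun (ξ : DiffCharacter m X) {β : BoundaryCircle S}
    (c : SurfaceFund β) : IsSectionRule ξ β (canonicalFun ξ c) := by
  intro ν σ σ' hσ hσ'
  rw [canonicalFun, canonicalFun, sphereVal, ← ξ.val_add]
  congr 1
  exact Subtype.ext (sub_add_sub_cancel _ _ _).symm

variable {ξ : DiffCharacter m X} {γ : LoopSpace m X}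

lemma Fibre.mk_eq_mk_iff {σ σ' : DiscMap m X} (hσ : DiscMap.bdry σ = γ)
    (hσ' : DiscMap.bdry σ' = γ) {z z' : ℂ} :
    Fibre.mk ξ σ hσ z = Fibre.mk ξ σ' hσ' z' ↔ z = sphereVal ξ σ σ' (hσ.trans hσ'.symm) * z' :=
  Quotient.eq (r := fibreSetoid ξ γ)

lemma Fibre.mk_inj {σ : DiscMap m X} (hσ : DiscMap.bdry σ = γ) {z z' : ℂ} :
    Fibre.mk ξ σ hσ z = Fibre.mk ξ σ hσ z' ↔ z = z' := by
  rw [Fibre.mk_eq_mk_iff, sphereVal_self, one_mul]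

lemma Fibre.smul_mk {σ : DiscMap m X} (hσ : DiscMap.bdry σ = γ) (w z : ℂ) :
    w • Fibre.mk ξ σ hσ z = Fibre.mk ξ σ hσ (w * z) := rfl

/-- A vector `[σ, a]` with `a ≠ 0` is a basis of the fibre. -/
lemma Fibre.existsUnique_eq_smul_mk {σ : DiscMap m X} (hσ : DiscMap.bdry σ = γ) {a : ℂ}
    (ha : a ≠ 0) (v : Fibre ξ γ) : ∃! w : ℂ, v = w • Fibre.mk ξ σ hσ a := by
  obtain ⟨⟨⟨τ, hτ⟩, z⟩, rfl⟩ := Quotient.exists_rep v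
  have hv : Fibre.mk ξ τ hτ z = Fibre.mk ξ σ hσ (sphereVal ξ σ τ (hσ.trans hτ.symm) * z) :=
    ((Fibre.mk_eq_mk_iff hσ hτ).2 rfl).symm
  change ∃! w : ℂ, Fibre.mk ξ τ hτ z = _
  simp only [hv, Fibre.smul_mk, Fibre.mk_inj]
  exact ⟨_, (div_mul_cancel₀ _ ha).symm, fun w hw => by rw [hw, mul_div_cancel_right₀ _ ha]⟩

lemma Fibre.not_isZero_mk {σ : DiscMap m X} (hσ : DiscMap.bdry σ = γ) {a : ℂ} (ha : a ≠ 0) :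
    ¬ (Fibre.mk ξ σ hσ a).IsZero := by
  rintro ⟨τ, hτ, h⟩
  rw [Fibre.mk_eq_mk_iff, mul_zero] at h
  exact ha h

end Section

end LoopLine

end
theorem mainTheorem8 {m : ℕ} {X : Type*} [TopologicalSpace X]
    [ChartedSpace (EuclideanSpace ℝ (Fin m)) X] [IsManifold (𝓡 m) ∞ X]
    [T2Space X] [SecondCountableTopology X] [SimplyConnectedSpace X]
    {S : Type*} [TopologicalSpace S] [ChartedSpace (EuclideanHalfSpace 2) S]
    [IsManifold (𝓡∂ 2) ∞ S] [T2Space S] [CompactSpace S] [ConnectedSpace S]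
    (β : LoopLine.BoundaryCircle S) (c : LoopLine.SurfaceFund β)
    (ξ : LoopLine.DiffCharacter m X) :
    -- `h(σ # ν)` depends only on the map, not on the chains that represent the
    -- fundamental classes of the disc and of the surface
    (∀ (d : LoopLine.FundChain LoopLine.discBdry) (c' : LoopLine.SurfaceFund β),
      c'.chain - c.chain ∈ LinearMap.range (LoopLine.boundary 2) →
      ∀ p : LoopLine.FibreProduct m X β,
        ξ.val (LoopLine.glueSurface d c' p) = LoopLine.canonicalFun ξ c p) ∧
    -- the transformation rule of a section
    LoopLine.IsSectionRule ξ β (LoopLine.canonicalFun ξ c) ∧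
    -- it vanishes nowhere
    (∀ p : LoopLine.FibreProduct m X β, LoopLine.canonicalFun ξ c p ≠ 0) ∧
    -- it defines a unique section of `∂⁻¹(L_ξ)` over `Σ(X)`, which vanishes nowhere
    -- and trivialises every fibre
    ∃ s : LoopLine.PullbackSection ξ β,
      s.IsGivenBy (LoopLine.canonicalFun ξ c) ∧
      (∀ s' : LoopLine.PullbackSection ξ β,
        s'.IsGivenBy (LoopLine.canonicalFun ξ c) → s' = s) ∧
      (∀ ν, ¬ (s ν).IsZero) ∧
      (∀ ν (v : LoopLine.Fibre ξ (LoopLine.SurfaceMap.bdry β ν)), ∃! w : ℂ, v = w • s ν) := by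
  have hrule := LoopLine.isSectionRule_canonicalFun ξ c
  have hne : ∀ p : LoopLine.FibreProduct m X β, LoopLine.canonicalFun ξ c p ≠ 0 :=
    fun p => ξ.val_ne_zero _
  choose σ hσ using fun ν : LoopLine.SurfaceMap m X S =>
    LoopLine.exists_discMap_bdry_eq (LoopLine.SurfaceMap.bdry β ν)
  refine ⟨fun d c' hc p => LoopLine.val_glueSurface_eq ξ hc p, hrule, hne,
    fun ν => LoopLine.Fibre.mk ξ (σ ν) (hσ ν) (LoopLine.canonicalFun ξ c ⟨(σ ν, ν), hσ ν⟩),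
    fun ν τ hτ => (LoopLine.Fibre.mk_eq_mk_iff (hσ ν) hτ).2 (hrule ν (σ ν) τ (hσ ν) hτ),
    fun s' hs' => funext fun ν => hs' ν (σ ν) (hσ ν),
    fun ν => LoopLine.Fibre.not_isZero_mk (hσ ν) (hne _),
    fun ν v => LoopLine.Fibre.existsUnique_eq_smul_mk (hσ ν) (hne _) v⟩
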